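/- Let $n\ge 2$ and let $G=\mathrm{GL}(n)$ or $G=\mathrm{SL}(n)$, with centre $Z$. Fix a signature $\underline r=(r_1,r_2)$ with $d=r_1+2r_2\ge 2$, and put $\mathbb R^{\underline r}=\mathbb R^{r_1}\times\mathbb C^{r_2}$. For a number field $F$ of signature $\underline r$ identify $F_\infty=F\otimes\mathbb R$ with $\mathbb R^{\underline r}$ by an isomorphism of topological rings, and embed $F$ in a fixed algebraic closure $\overline{\mathbb Q}$ of $\mathbb Q$; both choices are arbitrary. For $f_\infty\in C_c^\infty(G(\mathbb R^{\underline r}))$ let $f_F=f_\infty\cdot\mathbf 1_{\mathbf K_f^F}$, a function on $G(\mathbb A_F)$, where $\mathbf K_f^F=\prod_{v<\infty}G(\mathcal O_{F_v})$. Let $G(\mathbb A_F)^1=\{g\in G(\mathbb A_F):|\det g|_{\mathbb A_F}=1\}$, with an arbitrary Haar measure; $G(F)$ carries the counting measure. Let $\mathfrak a=\{T\in\mathbb R^n:\sum_i T_i=0\}$ and $\mathfrak a^+=\{T\in\mathfrak a: T_i-T_j>0\text{ for all }i<j\}$, and let $\varpi_k(X)=X_1+\dots+X_k$ for $1\le k<n$.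 Let $\mathbf K_\infty$ be the standard maximal compact subgroup (a product of (special) orthogonal and (special) unitary groups). For $g=tuk\in G(\mathbb A_F)$ with $t=\mathrm{diag}(t_1,\dots,t_n)$, $u$ upper triangular unipotent and $k\in\mathbf K_\infty\mathbf K_f^F$, put $H_0(g)=(\log|t_1|_{\mathbb A_F},\dots,\log|t_n|_{\mathbb A_F})$. Let $F(\cdot,T)$ be the characteristic function of the set of all $x$ with $\varpi_k(H_0(\delta x)-T)\le 0$ for all $\delta\in G(F)$ and all $1\le k<n$. Put $$j^{F,T}_{G\smallsetminus Z}(f_F)=\int_{G(F)\backslash G(\mathbb A_F)^1}F(x,T)\sum_{\gamma\in G(F)\smallsetminus Z(F)}f_F(x^{-1}\gamma x)\,dx .$$ Two elements of $G(F)$ are in the same geometric equivalence class $\mathfrak o$ if the semisimple parts of their Jordan decompositions are conjugate in $G(F)$; $\chi_{\mathfrak o}\in F[X]\subseteq\overline{\mathbb Q}[X]$ is the characteristic polynomial of these semisimple parts. **Proposition.** For every compact set $C\subseteq G(\mathbb R^{\underline r})$ there are finitely many polynomials $\chi_1,\dots,\chi_s\in\overline{\mathbb Q}[X]$ such that the following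 holds for every $f_\infty\in C_c^\infty(G(\mathbb R^{\underline r}))$ with support in $C$ and every number field $F$ of signature $\underline r$. Let $\Sigma(F)\subseteq G(F)$ be the union of all geometric equivalence classes $\mathfrak o$ with $\chi_{\mathfrak o}\in\{\chi_1,\dots,\chi_s\}$. If $x\in G(\mathbb A_F)^1$, $\gamma\in G(F)$ and $f_F(x^{-1}\gamma x)\ne 0$, then $\gamma\in\Sigma(F)$; and, for every $\rho>0$ and every $T\in\mathfrak a^+$ with $T_i-T_j\ge\rho\log D_F$ for all $i<j$ ($D_F$ being the absolute discriminant of $F$), $$j^{F,T}_{G\smallsetminus Z}(f_F)=\int_{G(F)\backslash G(\mathbb A_F)^1}F(x,T)\sum_{\gamma\in\Sigma(F)\smallsetminus Z(F)}f_F(x^{-1}\gamma x)\,dx .$$ -/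

import Mathlib

open Polynomial NumberField MeasureTheory IsDedekindDomain
open scoped ContDiff

noncomputable section

namespace TruncTrace

/-! ### The groups `GL(n)` and `SL(n)` -/

/-- The two kinds of groups under consideration, `GL(n)` (general) and `SL(n)` (special). -/
inductive GroupKind
  | general
  | special

/-- The group of `R`-points of `GL(n)` or of `SL(n)`, as a subgroup of `GL_n(R)`
(with the topology of `GL_n(R)` when `R` is a topological ring). -/
def linGroup (G : GroupKind) (n : ℕ) (R : Type*) [CommRing R] :
    Subgroup (Matrix.GeneralLinearGroup (Fin n) R) :=
  match G with
  | .general => ⊤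
  | .special => (Matrix.GeneralLinearGroup.det (n := Fin n) (R := R)).ker

/-- The matrix of an element of the group. -/
def toMat {G : GroupKind} {n : ℕ} {R : Type*} [CommRing R] (g : linGroup G n R) :
    Matrix (Fin n) (Fin n) R :=
  ((g : Matrix.GeneralLinearGroup (Fin n) R) : Matrix (Fin n) (Fin n) R)

/-- A ring homomorphism `R → S` induces a homomorphism `G(R) → G(S)`, entry by entry. -/
def linMap (G : GroupKind) (n : ℕ) {R S : Type*} [CommRing R] [CommRing S] (φ : R →+* S) :
    linGroup G n R →* linGroup G n S :=
  ((Matrix.GeneralLinearGroup.map φ).comp (linGroup G n R).subtype).codRestrict (linGroup G n S)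
    (by
      rintro ⟨g, hg⟩
      cases G with
      | general => exact Subgroup.mem_top _
      | special =>
        have hg' : Matrix.GeneralLinearGroup.det g = 1 := hg
        change Matrix.GeneralLinearGroup.det (Matrix.GeneralLinearGroup.map φ g) = 1
        rw [Matrix.GeneralLinearGroup.map_det, hg', map_one])

/-! ### Jordan decomposition and geometric equivalence classes -/

section Jordan

variable {G : GroupKind} {n : ℕ} {F : Type*} [Field F]

/-- `γ = s u` is the (multiplicative) Jordan decomposition of `γ`: the elements `s` and `u`
commute, `s` is semisimple and `u` is unipotent. -/
structure IsJordan (γ s u : linGroup G n F) : Prop where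
  eq_mul : γ = s * u
  commute : s * u = u * s
  semisimple : Module.End.IsSemisimple (Matrix.toLinAlgEquiv' (toMat s))
  unipotent : IsNilpotent (toMat u - 1)

theorem toMat_mul (a b : linGroup G n F) : toMat (a * b) = toMat a * toMat b := rfl

theorem toMat_one : toMat (1 : linGroup G n F) = 1 := rfl

theorem toMat_injective : Function.Injective (toMat : linGroup G n F → _) := fun _ _ h =>
  Subtype.ext (Units.ext h)

theorem toMat_mul_inv (a : linGroup G n F) : toMat a * toMat a⁻¹ = 1 := by
  rw [← toMat_mul, mul_inv_cancel, toMat_one]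

theorem toMat_inv_mul (a : linGroup G n F) : toMat a⁻¹ * toMat a = 1 := by
  rw [← toMat_mul, inv_mul_cancel, toMat_one]

theorem det_of_unipotent {M : Matrix (Fin n) (Fin n) F} (h : IsNilpotent (M - 1)) :
    M.det = 1 := by
  have h1 := (Matrix.isNilpotent_charpoly_sub_pow_of_isNilpotent h).eq_zero
  have h2 : (M - 1).charpoly.eval (-1) = (-1) ^ n := by
    rw [sub_eq_zero.1 h1]; simp
  rw [Matrix.eval_charpoly] at h2
  have h3 : (Matrix.scalar (Fin n) (-1 : F) - (M - 1)) = -M := by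
    rw [map_neg, map_one]; abel
  rw [h3, Matrix.det_neg, Fintype.card_fin] at h2
  have h4 : ((-1 : F) ^ n) ≠ 0 := pow_ne_zero _ (by simp)
  exact mul_left_cancel₀ h4 (by rw [h2, mul_one])

theorem exists_isJordan [PerfectField F] (γ : linGroup G n F) :
    ∃ s u : linGroup G n F, IsJordan γ s u := by
  obtain ⟨N, hN, S, hS, hNn, hSs, hγ⟩ :=
    Module.End.exists_isNilpotent_isSemisimple (f := Matrix.toLinAlgEquiv' (toMat γ))
  set φ := (Matrix.toLinAlgEquiv' (R := F) (n := Fin n)) with hφ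
  have hNS : Commute N S :=
    Algebra.commute_of_mem_adjoin_singleton_of_commute hS
      (Algebra.commute_of_mem_adjoin_self hN).symm
  obtain ⟨s, rfl⟩ := φ.surjective S
  obtain ⟨m, rfl⟩ := φ.surjective N
  have hm : IsNilpotent m := (IsNilpotent.map_iff φ.injective).1 hNn
  have hms : Commute m s := by
    apply φ.injective
    simpa only [map_mul] using hNS.eq
  have hg : toMat γ = m + s := by
    apply φ.injective
    simpa only [map_add] using hγ
  have hsγ : s = toMat γ - m := by rw [hg]; abel
  have hmγ : Commute m (toMat γ) := by
    rw [hg]; exact (Commute.refl m).add_right hms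
  have hγu : IsUnit (toMat γ) := (γ : Matrix.GeneralLinearGroup (Fin n) F).isUnit
  have hsu : IsUnit s := by
    have := hm.neg.isUnit_add_left_of_commute hγu hmγ.neg_left
    rwa [← sub_eq_add_neg, ← hsγ] at this
  obtain ⟨σ, rfl⟩ := hsu
  have hmσ : Commute m (↑σ⁻¹ : Matrix (Fin n) (Fin n) F) := hms.units_inv_right
  have hu : IsNilpotent ((↑σ⁻¹ : Matrix (Fin n) (Fin n) F) * toMat γ - 1) := by
    have : (↑σ⁻¹ : Matrix (Fin n) (Fin n) F) * toMat γ - 1 =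
        (↑σ⁻¹ : Matrix (Fin n) (Fin n) F) * m := by
      rw [hg, mul_add, Units.inv_mul, add_sub_cancel_right]
    rw [this]
    exact hmσ.symm.isNilpotent_mul_left hm
  have hmem : σ ∈ linGroup G n F := by
    cases G with
    | general => exact Subgroup.mem_top _
    | special =>
      have hdet := det_of_unipotent hu
      have h1 : (toMat γ).det = 1 := by
        have : Matrix.GeneralLinearGroup.det (γ : Matrix.GeneralLinearGroup (Fin n) F) = 1 := γ.2
        exact congrArg Units.val this
      rw [Matrix.det_mul, h1, mul_one] at hdet
      have h2 : (Matrix.GeneralLinearGroup.det σ⁻¹) = 1 := Units.ext hdet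
      change Matrix.GeneralLinearGroup.det σ = 1
      simpa using h2
  have hcomm : Commute (toMat γ) (σ : Matrix (Fin n) (Fin n) F) := by
    rw [hg]; exact hms.add_left (Commute.refl _)
  obtain ⟨τ, hτ⟩ : ∃ τ : linGroup G n F, toMat τ = (σ : Matrix (Fin n) (Fin n) F) :=
    ⟨⟨σ, hmem⟩, rfl⟩
  have hτ' : toMat τ⁻¹ = (↑σ⁻¹ : Matrix (Fin n) (Fin n) F) := by
    refine (Units.inv_eq_of_mul_eq_one_right ?_).symm
    rw [← hτ, toMat_mul_inv]
  have hτγ : τ * γ = γ * τ := by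
    apply toMat_injective
    rw [toMat_mul, toMat_mul, hτ]
    exact hcomm.symm
  refine ⟨τ, τ⁻¹ * γ, by group, ?_, ?_, ?_⟩
  · rw [mul_inv_cancel_left, mul_assoc, ← hτγ, inv_mul_cancel_left]
  · rw [hτ]; exact hSs
  · rw [toMat_mul, hτ']; exact hu

theorem IsJordan.unique [PerfectField F] {γ s u s' u' : linGroup G n F}
    (h : IsJordan γ s u) (h' : IsJordan γ s' u') : s = s' := by
  have key : ∀ {s u : linGroup G n F}, IsJordan γ s u →
      IsNilpotent (Matrix.toLinAlgEquiv' (toMat s * (toMat u - 1))) ∧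
      Commute (Matrix.toLinAlgEquiv' (toMat s * (toMat u - 1)))
        (Matrix.toLinAlgEquiv' (toMat s)) ∧
      Matrix.toLinAlgEquiv' (toMat γ) =
        Matrix.toLinAlgEquiv' (toMat s * (toMat u - 1)) + Matrix.toLinAlgEquiv' (toMat s) := by
    intro s u h
    have hc : Commute (toMat s) (toMat u) := congrArg toMat h.commute
    have hc1 : Commute (toMat s) (toMat u - 1) := hc.sub_right (Commute.one_right _)
    refine ⟨?_, ?_, ?_⟩
    · exact (hc1.isNilpotent_mul_left h.unipotent).map _
    · exact ((Commute.refl (toMat s)).mul_left hc1.symm).map _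
    · rw [← map_add, h.eq_mul, toMat_mul, mul_sub, mul_one, sub_add_cancel]
  obtain ⟨a, b, c⟩ := key h
  obtain ⟨a', b', c'⟩ := key h'
  exact toMat_injective (Matrix.toLinAlgEquiv'.injective
    (Module.End.isNilpotent_isSemisimple_unique a h.semisimple a' h'.semisimple b b'
      (c.symm.trans c')).2)

/-- The semisimple part `γ_s` of `γ` in its Jordan decomposition in `G(F)`. -/
def semisimplePart [PerfectField F] (γ : linGroup G n F) : linGroup G n F :=
  (exists_isJordan γ).choose

theorem semisimplePart_spec [PerfectField F] (γ : linGroup G n F) :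
    ∃ u, IsJordan γ (semisimplePart γ) u :=
  (exists_isJordan γ).choose_spec

theorem semisimplePart_conj [PerfectField F] (g γ : linGroup G n F) :
    semisimplePart (g * γ * g⁻¹) = g * semisimplePart γ * g⁻¹ := by
  obtain ⟨u, hu⟩ := semisimplePart_spec γ
  obtain ⟨u', hu'⟩ := semisimplePart_spec (g * γ * g⁻¹)
  refine hu'.unique (u' := g * u * g⁻¹) ⟨?_, ?_, ?_, ?_⟩
  · conv_lhs => rw [hu.eq_mul]
    group
  · have := hu.commute
    calc g * semisimplePart γ * g⁻¹ * (g * u * g⁻¹)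
        = g * (semisimplePart γ * u) * g⁻¹ := by group
      _ = g * (u * semisimplePart γ) * g⁻¹ := by rw [this]
      _ = _ := by group
  · let A : (Fin n → F) ≃ₗ[F] (Fin n → F) :=
      LinearEquiv.ofLinearMap (Matrix.toLinAlgEquiv' (toMat g)) (Matrix.toLinAlgEquiv' (toMat g⁻¹))
        (by
          change Matrix.toLinAlgEquiv' (toMat g) * Matrix.toLinAlgEquiv' (toMat g⁻¹) = 1
          rw [← map_mul, toMat_mul_inv, map_one])
        (by
          change Matrix.toLinAlgEquiv' (toMat g⁻¹) * Matrix.toLinAlgEquiv' (toMat g) = 1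
          rw [← map_mul, toMat_inv_mul, map_one])
    have h1 : Matrix.toLinAlgEquiv' (toMat (g * semisimplePart γ * g⁻¹)) =
        A.conj (Matrix.toLinAlgEquiv' (toMat (semisimplePart γ))) := by
      rw [toMat_mul, toMat_mul, map_mul, map_mul]; rfl
    rw [h1]
    refine (LinearEquiv.isSemisimple_iff _ _ A ?_).1 hu.semisimple
    ext x
    simp [LinearEquiv.conj_apply]
  · have h2 : toMat (g * u * g⁻¹) - 1 = toMat g * (toMat u - 1) * toMat g⁻¹ := by
      rw [mul_sub, sub_mul, mul_one, toMat_mul_inv, toMat_mul, toMat_mul]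
    rw [h2]
    obtain ⟨k, hk⟩ := hu.unipotent
    refine ⟨k, ?_⟩
    have h3 : ∀ m : ℕ, (toMat g * (toMat u - 1) * toMat g⁻¹) ^ m =
        toMat g * (toMat u - 1) ^ m * toMat g⁻¹ := by
      intro m
      induction m with
      | zero => rw [pow_zero, pow_zero, mul_one, toMat_mul_inv]
      | succ m ih =>
        rw [pow_succ, ih, pow_succ]
        simp only [mul_assoc]
        rw [← mul_assoc (toMat g⁻¹), toMat_inv_mul, one_mul]
    rw [h3, hk, mul_zero, zero_mul]

variable (G n F) in
/-- Two elements of `G(F)` are geometrically equivalent if their semisimple parts are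
conjugate in `G(F)`. -/
def geomSetoid [PerfectField F] : Setoid (linGroup G n F) where
  r γ₁ γ₂ := IsConj (semisimplePart γ₁) (semisimplePart γ₂)
  iseqv := ⟨fun _ => IsConj.refl _, IsConj.symm, IsConj.trans⟩

variable (G n F) in
/-- The set of geometric equivalence classes of `G(F)`. -/
abbrev GeomClass [PerfectField F] : Type _ := Quotient (geomSetoid G n F)

/-- The geometric equivalence class as a subset of `G(F)`. -/
def GeomClass.carrier [PerfectField F] (o : GeomClass G n F) : Set (linGroup G n F) :=
  {γ | Quotient.mk (geomSetoid G n F) γ = o}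

/-- The characteristic polynomial of the semisimple conjugacy class attached to a geometric
equivalence class. -/
def GeomClass.charpoly [PerfectField F] (o : GeomClass G n F) : F[X] :=
  Quotient.lift (fun γ : linGroup G n F => (toMat (semisimplePart γ)).charpoly)
    (by
      intro a b h
      obtain ⟨c, hc⟩ := isConj_iff.1 h
      have hd : toMat (semisimplePart b) =
          toMat c * toMat (semisimplePart a) * toMat c⁻¹ := by
        rw [← hc, toMat_mul, toMat_mul]
      change (toMat (semisimplePart a)).charpoly = (toMat (semisimplePart b)).charpoly
      rw [hd, ← Matrix.charpoly_units_conj (c : Matrix.GeneralLinearGroup (Fin n) F)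
        (toMat (semisimplePart a)), ← Matrix.coe_units_inv]
      rfl) o

/-- The union of all geometric equivalence classes in `G(F)` whose characteristic polynomial,
viewed in `ℚ̄[X]` through the embedding `ι`, belongs to the finite set `S`. -/
def classUnion (G : GroupKind) (n : ℕ) {F : Type*} [Field F] [PerfectField F]
    (ι : F →+* AlgebraicClosure ℚ) (S : Finset (AlgebraicClosure ℚ)[X]) :
    Set (linGroup G n F) :=
  ⋃ o ∈ {o : GeomClass G n F | o.charpoly.map ι ∈ S}, o.carrier

/-- Stability under conjugation by all elements of the group. -/
def ConjStable {H : Type*} [Group H] (A : Set H) : Prop :=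
  ∀ g : H, ∀ γ ∈ A, g * γ * g⁻¹ ∈ A

theorem conjStable_classUnion [PerfectField F] (ι : F →+* AlgebraicClosure ℚ)
    (S : Finset (AlgebraicClosure ℚ)[X]) : ConjStable (classUnion G n ι S) := by
  intro g γ hγ
  simp only [classUnion, Set.mem_iUnion] at hγ ⊢
  obtain ⟨o, ho, hγo⟩ := hγ
  refine ⟨o, ho, ?_⟩
  have h : Quotient.mk (geomSetoid G n F) (g * γ * g⁻¹) = Quotient.mk (geomSetoid G n F) γ := by
    apply Quotient.sound
    change IsConj (semisimplePart (g * γ * g⁻¹)) (semisimplePart γ)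
    rw [semisimplePart_conj]
    exact (isConj_iff.2 ⟨g, rfl⟩ : IsConj (semisimplePart γ) _).symm
  exact h.trans hγo

end Jordan

theorem ConjStable.diff_center {H : Type*} [Group H] {A : Set H} (hA : ConjStable A) :
    ConjStable (A \ (Subgroup.center H : Set H)) := by
  rintro g γ ⟨hγ, hc⟩
  refine ⟨hA g γ hγ, fun h => hc ?_⟩
  have := Subgroup.Normal.conj_mem inferInstance _ h g⁻¹
  rw [show g⁻¹ * (g * γ * g⁻¹) * g⁻¹⁻¹ = γ by group] at this
  exact this

theorem conjStable_univ {H : Type*} [Group H] : ConjStable (Set.univ : Set H) :=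
  fun _ _ _ => Set.mem_univ _

/-! ### Test functions on the archimedean group -/

/-- The algebra `ℝ^r = ℝ^{r₁} × ℂ^{r₂}`. -/
abbrev ArchAlg (r₁ r₂ : ℕ) : Type := (Fin r₁ → ℝ) × (Fin r₂ → ℂ)

/-- A function on `G(ℝ^r)` is smooth if near every point it is the restriction of a smooth
function of the matrix entries (`G(ℝ^r)` is a submanifold of the real vector space of
matrices over `ℝ^r`). -/
def IsSmooth {G : GroupKind} {n r₁ r₂ : ℕ} (f : linGroup G n (ArchAlg r₁ r₂) → ℂ) : Prop :=
  ∀ g : linGroup G n (ArchAlg r₁ r₂), ∃ h : (Fin n → Fin n → ArchAlg r₁ r₂) → ℂ,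
    ContDiff ℝ ∞ h ∧ ∀ᶠ x in nhds g, f x = h (fun i j => toMat x i j)

/-! ### Adelic groups -/

section Adelic

variable (F : Type*) [Field F] [NumberField F]

/-- Projection of the adeles to the archimedean component `F_∞`. -/
def archProj : AdeleRing (𝓞 F) F →+* InfiniteAdeleRing F :=
  RingHom.fst (InfiniteAdeleRing F) (FiniteAdeleRing (𝓞 F) F)

/-- Projection of the adeles to the finite adeles. -/
def finProj : AdeleRing (𝓞 F) F →+* FiniteAdeleRing (𝓞 F) F :=
  RingHom.snd (InfiniteAdeleRing F) (FiniteAdeleRing (𝓞 F) F)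

variable {F}

/-- The product of the normalized absolute values `∏_v |a_v|_v`, for an idele `a`. -/
def adelicAbs (a : (AdeleRing (𝓞 F) F)ˣ) : ℝ :=
  (∏ v : InfinitePlace F, ‖archProj F a v‖ ^ v.mult) *
    ∏ᶠ v : HeightOneSpectrum (𝓞 F), ‖finProj F a v‖

theorem finite_mulSupport_norm (a : (AdeleRing (𝓞 F) F)ˣ) :
    (Function.mulSupport fun v : HeightOneSpectrum (𝓞 F) => ‖finProj F a v‖).Finite := by
  have h := (FiniteAdeleRing.isUnit_iff.1 (a.isUnit.map (finProj F))).2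
  refine Set.Finite.subset (Filter.eventually_cofinite.1 h) fun v hv hv' => hv ?_
  change ‖finProj F a v‖ = 1
  rw [FinitePlace.norm_def, hv', map_one, NNReal.coe_one]

variable (F) in
/-- The adelic absolute value on the ideles. -/
def ideleNorm : (AdeleRing (𝓞 F) F)ˣ →* ℝ where
  toFun := adelicAbs
  map_one' := by
    have h1 : ∀ v : InfinitePlace F, archProj F (1 : (AdeleRing (𝓞 F) F)ˣ) v = 1 := fun _ => rfl
    have h2 : ∀ v : HeightOneSpectrum (𝓞 F), finProj F (1 : (AdeleRing (𝓞 F) F)ˣ) v = 1 :=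
      fun _ => rfl
    simp only [adelicAbs, h1, h2, norm_one, one_pow, Finset.prod_const_one, finprod_one, mul_one]
  map_mul' a b := by
    have h1 : ∀ v : InfinitePlace F, archProj F (a * b : (AdeleRing (𝓞 F) F)ˣ) v =
      archProj F a v * archProj F b v := fun _ => rfl
    have h2 : ∀ v : HeightOneSpectrum (𝓞 F), finProj F (a * b : (AdeleRing (𝓞 F) F)ˣ) v =
      finProj F a v * finProj F b v := fun _ => rfl
    simp only [adelicAbs, h1, h2, norm_mul, mul_pow, Finset.prod_mul_distrib]
    rw [finprod_mul_distrib (finite_mulSupport_norm a) (finite_mulSupport_norm b)]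
    ring

variable (G : GroupKind) (n : ℕ)

variable (F) in
/-- `G(𝔸_F)`. -/
abbrev adelicGroup : Subgroup (Matrix.GeneralLinearGroup (Fin n) (AdeleRing (𝓞 F) F)) :=
  linGroup G n (AdeleRing (𝓞 F) F)

variable (F) in
/-- `G(𝔸_F)^1`, the group of all `g ∈ G(𝔸_F)` with `|det g| = 1`. -/
abbrev adelicOne : Subgroup (adelicGroup F G n) :=
  ((ideleNorm F).comp
    (Matrix.GeneralLinearGroup.det.comp (adelicGroup F G n).subtype)).ker

variable (F) in
/-- The diagonal embedding `G(F) → G(𝔸_F)`. -/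
abbrev diagEmb : linGroup G n F →* adelicGroup F G n :=
  linMap G n (algebraMap F (AdeleRing (𝓞 F) F))

variable (F) in
/-- `G(F)` as a subgroup of `G(𝔸_F)^1`. -/
abbrev rationalSubgroup : Subgroup (adelicOne F G n) :=
  (diagEmb F G n).range.subgroupOf (adelicOne F G n)

variable (F) in
/-- The quotient `G(F) \ G(𝔸_F)^1`. -/
abbrev AdelicQuotient : Type _ := Quotient (QuotientGroup.rightRel (rationalSubgroup F G n))

variable {G n}

/-- `g ∈ G(𝔸_F)` has its finite part in `K_f = ∏_{v<∞} G(𝒪_v)`. -/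
def FinPartInKf (g : adelicGroup F G n) : Prop :=
  ∀ (v : HeightOneSpectrum (𝓞 F)) (i j : Fin n),
    finProj F (toMat g i j) v ∈ v.adicCompletionIntegers F ∧
    finProj F (toMat g⁻¹ i j) v ∈ v.adicCompletionIntegers F

/-- `g ∈ G(𝔸_F)` has its archimedean part in `K_∞`, the product over the archimedean places of
the orthogonal groups (real places) and the unitary groups (complex places), intersected with
`SL(n)` for `G = SL(n)`.  At a real place the image of `F_v` in `ℂ` is `ℝ`, so that
"unitary" means "orthogonal" there. -/
def ArchPartInK (g : adelicGroup F G n) : Prop :=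
  ∀ v : InfinitePlace F,
    (Matrix.of fun i j => InfinitePlace.Completion.extensionEmbedding v
      (archProj F (toMat g i j) v)) ∈ Matrix.unitaryGroup (Fin n) ℂ

/-- `g = t u k` with `t = diag(t₁, …, t_n)`, `u` upper triangular unipotent and `k ∈ K`. -/
def IsIwasawa (g : adelicGroup F G n) (t : Fin n → (AdeleRing (𝓞 F) F)ˣ) : Prop :=
  ∃ u k : adelicGroup F G n,
    (∀ i, toMat u i i = 1) ∧ (∀ i j, j < i → toMat u i j = 0) ∧
    FinPartInKf k ∧ ArchPartInK k ∧
    toMat g = Matrix.diagonal (fun i => (t i : AdeleRing (𝓞 F) F)) * toMat u * toMat k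

open Classical in
/-- The Iwasawa projection `H₀(g) = (log |t₁|, …, log |t_n|)` for `g = t u k`. -/
def iwasawaProj (g : adelicGroup F G n) : Fin n → ℝ :=
  if h : ∃ t, IsIwasawa g t then fun i => Real.log (ideleNorm F (h.choose i)) else 0

/-- The fundamental weight `ϖ_k(X) = X_1 + ⋯ + X_k` on vectors with coordinate sum zero. -/
def fundWeight (k : ℕ) (X : Fin n → ℝ) : ℝ :=
  ∑ i : Fin n, if (i : ℕ) < k then X i else 0

open Classical in
/-- The truncation function `F(x, T)`: the characteristic function of the set of all `x` with
`ϖ(H₀(δ x) - T) ≤ 0` for all `δ ∈ G(F)` and all fundamental weights `ϖ`. -/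
def truncFn (T : Fin n → ℝ) (x : adelicGroup F G n) : ℂ :=
  if ∀ δ : linGroup G n F, ∀ k : ℕ, 1 ≤ k → k < n →
    fundWeight k (iwasawaProj (diagEmb F G n δ * x) - T) ≤ 0 then 1 else 0

open Classical in
/-- The test function `f_F = f_∞ · 1_{K_f}` on `G(𝔸_F)`, where `F_∞` is identified with `ℝ^r`
through `e`. -/
def testFn {r₁ r₂ : ℕ} (e : InfiniteAdeleRing F ≃+* ArchAlg r₁ r₂)
    (f : linGroup G n (ArchAlg r₁ r₂) → ℂ) (g : adelicGroup F G n) : ℂ :=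
  f (linMap G n ((e : InfiniteAdeleRing F →+* ArchAlg r₁ r₂).comp (archProj F)) g) *
    if FinPartInKf g then 1 else 0

/-- `F(x, T) ∑_{γ ∈ A} φ(x⁻¹ γ x)`. -/
def truncKernel (φ : adelicGroup F G n → ℂ) (T : Fin n → ℝ) (A : Set (linGroup G n F))
    (x : adelicGroup F G n) : ℂ :=
  truncFn T x * ∑' γ : A, φ (x⁻¹ * diagEmb F G n γ * x)

theorem truncFn_left_mul (T : Fin n → ℝ) (η : linGroup G n F) (x : adelicGroup F G n) :
    truncFn T (diagEmb F G n η * x) = truncFn T x := by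
  unfold truncFn
  congr 1
  refine propext ⟨fun h δ => ?_, fun h δ => ?_⟩
  · have := h (δ * η⁻¹)
    rwa [← mul_assoc, ← map_mul, inv_mul_cancel_right] at this
  · have := h (δ * η)
    rwa [map_mul, mul_assoc] at this

theorem truncKernel_left_mul (φ : adelicGroup F G n → ℂ) (T : Fin n → ℝ)
    {A : Set (linGroup G n F)} (hA : ConjStable A) (η : linGroup G n F)
    (x : adelicGroup F G n) :
    truncKernel φ T A (diagEmb F G n η * x) = truncKernel φ T A x := by
  unfold truncKernel
  rw [truncFn_left_mul]
  congr 1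
  let σ : A ≃ A :=
    { toFun := fun γ => ⟨η * γ * η⁻¹, hA η γ γ.2⟩
      invFun := fun γ => ⟨η⁻¹ * γ * η, by simpa using hA η⁻¹ γ γ.2⟩
      left_inv := fun γ => Subtype.ext (by simp [mul_assoc])
      right_inv := fun γ => Subtype.ext (by simp [mul_assoc]) }
  rw [← σ.tsum_eq]
  refine tsum_congr fun γ => congrArg φ ?_
  change (diagEmb F G n η * x)⁻¹ * diagEmb F G n (η * γ * η⁻¹) * (diagEmb F G n η * x) = _
  rw [map_mul, map_mul, map_inv]
  group

/-- The function `x ↦ F(x, T) ∑_{γ ∈ A} φ(x⁻¹ γ x)` on `G(F) \ G(𝔸_F)^1`, for a conjugation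
stable subset `A` of `G(F)`. -/
def truncKernelQuot (φ : adelicGroup F G n → ℂ) (T : Fin n → ℝ) (A : Set (linGroup G n F))
    (hA : ConjStable A) : AdelicQuotient F G n → ℂ :=
  Quotient.lift (fun x : adelicOne F G n => truncKernel φ T A x) (by
    intro a b h
    obtain ⟨η, hη⟩ : (b * a⁻¹ : adelicOne F G n) ∈ rationalSubgroup F G n :=
      QuotientGroup.rightRel_apply.1 h
    have hb : (b : adelicGroup F G n) = diagEmb F G n η * a := by
      rw [hη]; simp
    change truncKernel φ T A a = truncKernel φ T A b
    rw [hb, truncKernel_left_mul φ T hA])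

end Adelic

/-! ### The quotient measure -/

section QuotientMeasure

variable {H : Type*} [Group H] [MeasurableSpace H] (Γ : Subgroup H) (μ : Measure H)

/-- The measurable subsets of `H` that lie over `B ⊆ Γ \ H` and meet every orbit `Γ x` in at most
one point. -/
def sectionsOver (B : Set (Quotient (QuotientGroup.rightRel Γ))) : Set (Set H) :=
  {E | MeasurableSet E ∧ Set.InjOn (Quotient.mk (QuotientGroup.rightRel Γ)) E ∧
    E ⊆ Quotient.mk (QuotientGroup.rightRel Γ) ⁻¹' B}

/-- The supremum of `μ(E)` over all measurable `E` that lie over `B` and meet every `Γ`-orbit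
in at most one point. -/
def quotientVol (B : Set (Quotient (QuotientGroup.rightRel Γ))) : ENNReal :=
  ⨆ E ∈ sectionsOver Γ B, μ E

theorem quotientVol_empty : quotientVol Γ μ ∅ = 0 := by
  simp only [quotientVol, ENNReal.iSup_eq_zero]
  rintro E ⟨-, -, h⟩
  rw [Set.preimage_empty, Set.subset_empty_iff] at h
  rw [h, measure_empty]

theorem quotientVol_mono {A B : Set (Quotient (QuotientGroup.rightRel Γ))} (h : A ⊆ B) :
    quotientVol Γ μ A ≤ quotientVol Γ μ B :=
  biSup_mono fun _ hE => ⟨hE.1, hE.2.1, hE.2.2.trans (Set.preimage_mono h)⟩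

theorem quotientVol_union {A B : Set (Quotient (QuotientGroup.rightRel Γ))}
    (h : Disjoint A B) :
    quotientVol Γ μ A + quotientVol Γ μ B ≤ quotientVol Γ μ (A ∪ B) := by
  have hne : ∀ C : Set (Quotient (QuotientGroup.rightRel Γ)), (sectionsOver Γ C).Nonempty :=
    fun C => ⟨∅, MeasurableSet.empty, Set.injOn_empty _, Set.empty_subset _⟩
  refine ENNReal.biSup_add_biSup_le' (hne A) (hne B) fun E hE E' hE' => ?_
  have hd : Disjoint E E' :=
    Set.disjoint_left.2 fun x hx hx' => Set.disjoint_left.1 h (hE.2.2 hx) (hE'.2.2 hx')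
  rw [← measure_union hd hE'.1]
  refine le_biSup (f := fun E => μ E) ⟨hE.1.union hE'.1, ?_, ?_⟩
  · rintro x (hx | hx) y (hy | hy) hxy
    · exact hE.2.1 hx hy hxy
    · have h1 := hE.2.2 hx
      have h2 := hE'.2.2 hy
      rw [Set.mem_preimage] at h1 h2
      rw [hxy] at h1
      exact (Set.disjoint_left.1 h h1 h2).elim
    · have h1 := hE'.2.2 hx
      have h2 := hE.2.2 hy
      rw [Set.mem_preimage] at h1 h2
      rw [hxy] at h1
      exact (Set.disjoint_left.1 h h2 h1).elim
    · exact hE'.2.1 hx hy hxy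
  · rw [Set.preimage_union]
    exact Set.union_subset_union hE.2.2 hE'.2.2

theorem quotientVol_iUnion {B : ℕ → Set (Quotient (QuotientGroup.rightRel Γ))}
    (hB : ∀ i, MeasurableSet (B i)) (hd : Pairwise (Function.onFun Disjoint B)) :
    quotientVol Γ μ (⋃ i, B i) = ∑' i, quotientVol Γ μ (B i) := by
  apply le_antisymm
  · refine iSup₂_le fun E hE => ?_
    have hm : ∀ i, MeasurableSet (E ∩ Quotient.mk (QuotientGroup.rightRel Γ) ⁻¹' B i) :=
      fun i => hE.1.inter (measurable_quotient_mk'' (hB i))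
    have hEu : E = ⋃ i, E ∩ Quotient.mk (QuotientGroup.rightRel Γ) ⁻¹' B i := by
      rw [← Set.inter_iUnion, ← Set.preimage_iUnion]
      exact (Set.inter_eq_left.2 hE.2.2).symm
    have hdis : Pairwise (Function.onFun Disjoint
        fun i => E ∩ Quotient.mk (QuotientGroup.rightRel Γ) ⁻¹' B i) := fun i j hij =>
      ((hd hij).preimage _).mono Set.inter_subset_right Set.inter_subset_right
    rw [hEu, measure_iUnion hdis hm]
    exact ENNReal.tsum_le_tsum fun i => le_biSup (f := fun E => μ E)
      ⟨hm i, hE.2.1.mono Set.inter_subset_left, Set.inter_subset_right⟩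
  · rw [ENNReal.tsum_eq_iSup_sum]
    refine iSup_le fun s => ?_
    have key : ∑ i ∈ s, quotientVol Γ μ (B i) ≤ quotientVol Γ μ (⋃ i ∈ s, B i) := by
      classical
      induction s using Finset.induction_on with
      | empty => simp
      | insert a s ha ih =>
        rw [Finset.sum_insert ha, Finset.set_biUnion_insert]
        refine (add_le_add le_rfl ih).trans (quotientVol_union Γ μ ?_)
        refine Set.disjoint_iUnion₂_right.2 fun i hi => hd ?_
        rintro rfl
        exact ha hi
    exact key.trans (quotientVol_mono Γ μ (Set.iUnion₂_subset fun i _ => Set.subset_iUnion B i))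

/-- The measure on `Γ \ H` induced by a measure `μ` on `H` and the counting measure on a
countable discrete subgroup `Γ`: the measure of `B` is the supremum of `μ(E)` over the measurable
subsets `E` of the preimage of `B` that meet every `Γ`-orbit in at most one point.  (If `D` is a
measurable fundamental domain and `μ` is left invariant, this is the measure of the part of `D`
over `B`.) -/
def quotientMeasure : Measure (Quotient (QuotientGroup.rightRel Γ)) :=
  Measure.ofMeasurable (fun B _ => quotientVol Γ μ B) (quotientVol_empty Γ μ)
    fun _ hB hd => quotientVol_iUnion Γ μ hB hd

end QuotientMeasure

/-- The truncated integral
`∫_{G(F) \ G(𝔸_F)^1} F(x, T) ∑_{γ ∈ A} φ(x⁻¹ γ x) dx`, for a conjugation stable subset `A`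
of `G(F)` and a Haar measure `μ` on `G(𝔸_F)^1`. -/
def truncIntegral {F : Type*} [Field F] [NumberField F] {G : GroupKind} {n : ℕ}
    [MeasurableSpace (adelicOne F G n)] (μ : Measure (adelicOne F G n))
    (φ : adelicGroup F G n → ℂ) (T : Fin n → ℝ) (A : Set (linGroup G n F))
    (hA : ConjStable A) : ℂ :=
  ∫ q, truncKernelQuot φ T A hA q ∂(quotientMeasure (rationalSubgroup F G n) μ)

/-- The non-central truncated geometric integral `j^{F,T}_{G ∖ Z}(φ)`. -/
def jNonCentral {F : Type*} [Field F] [NumberField F] {G : GroupKind} {n : ℕ}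
    [MeasurableSpace (adelicOne F G n)] (μ : Measure (adelicOne F G n))
    (φ : adelicGroup F G n → ℂ) (T : Fin n → ℝ) : ℂ :=
  truncIntegral μ φ T (Set.univ \ (Subgroup.center (linGroup G n F) : Set (linGroup G n F)))
    conjStable_univ.diff_center

end TruncTrace

end

namespace TruncTrace

/-! ### The characteristic polynomial of the semisimple part -/

section Jordan

variable {G : GroupKind} {n : ℕ} {F : Type*} [Field F]

/-! The characteristic polynomial is invariant under conjugation, so a nonzero value `f_F(x⁻¹γx)`
constrains the coefficients of the characteristic polynomial of `γ`, whatever `x` is. At the finite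
places the conjugate has entries in the local integers, so the coefficients are algebraic integers
(`isIntegral_charpoly_coeff`). At infinity it lies in the compact set `C`, so all their complex
conjugates are bounded by a constant depending only on `C` (`norm_charpoly_coeff_le`). By
Northcott's argument, algebraic integers of fixed degree with bounded conjugates have only finitely
many images in the algebraic closure, uniformly in `F` and its embedding
(`exists_finite_of_bounded_conjugates`). Only finitely many polynomials remain.

Since `γ` and its semisimple part have the same characteristic polynomial (`IsJordan.charpoly_eq`),
this confines `γ` to finitely many `χ_𝔬`. All omitted terms of the kernel are then zero, and the two
integrands coincide pointwise. -/

theorem charpoly_add_of_isNilpotent_of_commute {m s : Matrix (Fin n) (Fin n) F}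
    (hm : IsNilpotent m) (hms : Commute m s) : (m + s).charpoly = s.charpoly := by
  -- Over the fraction field the characteristic matrix `A` of `s` is invertible, its determinant
  -- being monic. The characteristic matrix of `m + s` is `A - N = (1 - N A⁻¹) A`. As `N` commutes
  -- with `A`, the first factor is unipotent and has determinant 1.
  let φ : F[X] →+* FractionRing F[X] := algebraMap _ _
  have hφ : Function.Injective φ := IsFractionRing.injective F[X] (FractionRing F[X])
  apply hφ
  let A : Matrix (Fin n) (Fin n) (FractionRing F[X]) := φ.mapMatrix s.charmatrix
  let N : Matrix (Fin n) (Fin n) (FractionRing F[X]) := φ.mapMatrix (C.mapMatrix m)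
  have hA : IsUnit A := by
    rw [Matrix.isUnit_iff_isUnit_det, isUnit_iff_ne_zero, ← RingHom.map_det]
    exact (map_ne_zero_iff φ hφ).2 s.charpoly_monic.ne_zero
  have hN : IsNilpotent N := (hm.map C.mapMatrix).map φ.mapMatrix
  have hc : Commute (C.mapMatrix m) s.charmatrix := by
    rw [Matrix.charmatrix]
    exact (Matrix.scalar_commute _ (fun _ => Commute.all _ _) _).symm.sub_right
      (hms.map C.mapMatrix)
  have hNA : Commute N A := hc.map φ.mapMatrix
  obtain ⟨a, ha⟩ := hA
  have hNa : Commute N (↑a⁻¹ : Matrix (Fin n) (Fin n) (FractionRing F[X])) := by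
    rw [← ha] at hNA
    exact hNA.units_inv_right
  have hsum : φ.mapMatrix (m + s).charmatrix =
      (1 - N * (↑a⁻¹ : Matrix (Fin n) (Fin n) (FractionRing F[X]))) * A := by
    rw [sub_mul, one_mul, mul_assoc, ← ha, Units.inv_mul, mul_one, ha, ← map_sub]
    congr 1
    simp only [Matrix.charmatrix, map_add]
    abel
  have h1 : (1 - N * (↑a⁻¹ : Matrix (Fin n) (Fin n) (FractionRing F[X]))).det = 1 := by
    apply det_of_unipotent
    rw [sub_sub_cancel_left]
    exact (hNa.isNilpotent_mul_right hN).neg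
  rw [Matrix.charpoly, Matrix.charpoly, RingHom.map_det, RingHom.map_det, hsum, Matrix.det_mul, h1, one_mul]

/-- The multiplicative decomposition becomes additive: `γ = s + s(u - 1)`, with `s(u - 1)` nilpotent
and commuting with `s`. Thus `χ_𝔬` can be read off `γ` itself. -/
theorem IsJordan.charpoly_eq {γ s u : linGroup G n F} (h : IsJordan γ s u) :
    (toMat s).charpoly = (toMat γ).charpoly := by
  have hc : Commute (toMat s) (toMat u - 1) :=
    Commute.sub_right (congrArg toMat h.commute) (Commute.one_right _)
  rw [← charpoly_add_of_isNilpotent_of_commute (hc.isNilpotent_mul_left h.unipotent)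
    ((Commute.refl (toMat s)).mul_left hc.symm), h.eq_mul, toMat_mul, mul_sub, mul_one,
    sub_add_cancel]

theorem mem_classUnion [PerfectField F] {ι : F →+* AlgebraicClosure ℚ}
    {S : Finset (AlgebraicClosure ℚ)[X]} {γ : linGroup G n F}
    (h : (toMat γ).charpoly.map ι ∈ S) : γ ∈ classUnion G n ι S := by
  obtain ⟨u, hu⟩ := semisimplePart_spec γ
  refine Set.mem_biUnion (x := Quotient.mk (geomSetoid G n F) γ) ?_ rfl
  change (toMat (semisimplePart γ)).charpoly.map ι ∈ S
  rwa [hu.charpoly_eq]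

end Jordan

/-! ### Finiteness statements -/

theorem finite_setOf_natDegree_le_coeff_mem {R : Type*} [Semiring R] {U : Set R} (hU : U.Finite)
    (d : ℕ) : {p : R[X] | p.natDegree ≤ d ∧ ∀ i, p.coeff i ∈ U}.Finite := by
  let π : R[X] → Fin (d + 1) → R := fun f i => f.coeff i
  refine Set.Finite.of_finite_image (f := π)
    ((Set.Finite.pi fun _ => hU).subset (Set.image_subset_iff.2 fun f hf i _ => hf.2 i)) ?_
  intro p hp q hq h
  refine (ext_iff_natDegree_le hp.1 hq.1).2 fun i hi => ?_
  exact congrFun h ⟨i, Nat.lt_succ_of_le hi⟩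

/-- The algebraic integers of number fields of bounded degree all of whose conjugates are bounded
have only finitely many images in a fixed algebraic closure of `ℚ`. -/
theorem exists_finite_of_bounded_conjugates.{u} (d : ℕ) (B : ℝ) :
    ∃ U : Set (AlgebraicClosure ℚ), U.Finite ∧ ∀ (F : Type u) [Field F] [NumberField F],
      Module.finrank ℚ F = d → ∀ (ι : F →+* AlgebraicClosure ℚ) (x : F), IsIntegral ℤ x →
        (∀ φ : F →+* ℂ, ‖φ x‖ ≤ B) → ι x ∈ U := by
  classical
  -- The coefficients of the minimal polynomial are elementary symmetric functions of conjugates of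
  -- norm at most `B`; this is the resulting bound. `U` consists of the roots of the integer
  -- polynomials of degree at most `d` with coefficients in `[-c, c]`, so it involves neither `F`
  -- nor `ι`.
  let c := Nat.ceil (max B 1 ^ d * (d.choose (d / 2)))
  refine ⟨_, bUnion_roots_finite (algebraMap ℤ (AlgebraicClosure ℚ)) d
    (Set.finite_Icc (-c : ℤ) c), ?_⟩
  rintro F _ _ rfl ι x hx hB
  have h_min := minpoly.isIntegrallyClosed_eq_field_fractions' ℚ hx
  simp_rw [Set.mem_iUnion]
  refine ⟨minpoly ℤ x, ⟨?_, fun i => ?_⟩, ?_⟩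
  · rw [← (minpoly.monic hx).natDegree_map (algebraMap ℤ ℚ), ← h_min]
    exact minpoly.natDegree_le x
  · rw [Set.mem_Icc, ← abs_le, ← @Int.cast_le ℝ]
    refine (Eq.trans_le ?_ <| Embeddings.coeff_bdd_of_norm_le hB i).trans (Nat.le_ceil _)
    rw [h_min, coeff_map, eq_intCast, Int.norm_cast_rat, Int.norm_eq_abs, Int.cast_abs]
  · rw [Finset.mem_coe, Multiset.mem_toFinset,
      mem_roots ((minpoly.monic hx).map _).ne_zero, IsRoot.def, eval_map]
    -- The integer polynomial also kills `ι x`, because there is only one ring homomorphism out of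
    -- `ℤ`.
    have h := congrArg ι (minpoly.aeval ℤ x)
    rwa [aeval_def, hom_eval₂, map_zero, RingHom.ext_int (ι.comp _) (algebraMap ℤ _)] at h

/-! ### Continuous characters of `ℝ^r` and characteristic polynomials -/

/-- A continuous ring homomorphism to `ℂ` does not increase the norm. -/
theorem norm_le_of_continuous_ringHom {A : Type*} [NormedRing A] [NormedAlgebra ℝ A]
    (φ : A →+* ℂ) (hφ : Continuous φ) (x : A) : ‖φ x‖ ≤ ‖x‖ := by
  -- The powers of `y` tend to 0, hence so do those of `φ y` by continuity; they would blow up if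
  -- `‖φ y‖ > 1`.
  have key : ∀ y : A, ‖y‖ < 1 → ‖φ y‖ ≤ 1 := by
    intro y hy
    by_contra! h
    have h0 := (hφ.tendsto 0).comp (tendsto_pow_atTop_nhds_zero_of_norm_lt_one hy)
    have h1 := tendsto_pow_atTop_atTop_of_one_lt h
    rw [map_zero] at h0
    refine not_tendsto_nhds_of_tendsto_atTop h1 0 ?_
    simpa [Function.comp_def] using h0.norm
  by_contra! h
  -- The scaling factor is taken rational because a ring homomorphism respects rational scalars
  -- automatically.
  obtain ⟨q, hq1, hq2⟩ := exists_rat_btwn h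
  have hq : (0 : ℝ) < q := (norm_nonneg x).trans_lt hq1
  have hinv : ‖((q⁻¹ : ℚ) : ℝ)‖ = (q : ℝ)⁻¹ := by
    rw [Rat.cast_inv, norm_inv, Real.norm_of_nonneg hq.le]
  have h1 := key (((q⁻¹ : ℚ) : ℝ) • x) (by
    rw [norm_smul, hinv, inv_mul_lt_one₀ hq]
    exact hq1)
  rw [map_ratCast_smul φ ℝ ℝ, norm_smul, hinv, inv_mul_le_one₀ hq] at h1
  exact h1.not_gt hq2

theorem continuous_toMat {G : GroupKind} {n : ℕ} {R : Type*} [CommRing R] [TopologicalSpace R] :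
    Continuous (toMat : linGroup G n R → Matrix (Fin n) (Fin n) R) :=
  Units.continuous_val.comp continuous_subtype_val

/-- Each coefficient is a fixed polynomial in the matrix entries, read off the universal
characteristic polynomial. -/
theorem continuous_charpoly_coeff {n : ℕ} {R : Type*} [CommRing R] [TopologicalSpace R]
    [IsTopologicalRing R] (i : ℕ) :
    Continuous fun M : Matrix (Fin n) (Fin n) R => M.charpoly.coeff i := by
  have h : ∀ M : Matrix (Fin n) (Fin n) R, M.charpoly.coeff i =
      MvPolynomial.eval (fun p : Fin n × Fin n => M p.1 p.2)
        ((Matrix.charpoly.univ R (Fin n)).coeff i) := by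
    intro M
    exact (Matrix.charpoly.univ_coeff_eval₂Hom (Fin n) (RingHom.id R)
      (fun p : Fin n × Fin n => M p.1 p.2) i).symm
  simp only [h]
  exact (MvPolynomial.continuous_eval _).comp (by fun_prop)

theorem exists_charpoly_coeff_bound {G : GroupKind} {n r₁ r₂ : ℕ}
    {C : Set (linGroup G n (ArchAlg r₁ r₂))} (hC : IsCompact C) :
    ∃ B : ℝ, ∀ g ∈ C, ∀ i, ‖(toMat g).charpoly.coeff i‖ ≤ B := by
  have h : ∀ i : ℕ, ∃ B : ℝ, 0 ≤ B ∧ ∀ g ∈ C, ‖(toMat g).charpoly.coeff i‖ ≤ B := by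
    intro i
    obtain ⟨B, hB⟩ := hC.exists_bound_of_continuousOn
      ((continuous_charpoly_coeff i).comp (continuous_toMat (G := G))).continuousOn
    exact ⟨max B 0, le_max_right _ _, fun g hg => (hB g hg).trans (le_max_left _ _)⟩
  choose B hB0 hB using h
  -- The degree formula used below needs a nontrivial ring; for `r₁ = r₂ = 0` the ring is zero.
  obtain hs | hs := subsingleton_or_nontrivial (ArchAlg r₁ r₂)
  · exact ⟨0, fun g _ i => by rw [Subsingleton.elim ((toMat g).charpoly.coeff i) 0, norm_zero]⟩
  -- Only the indices up to `n` matter, since higher coefficients vanish; the sum of the nonnegative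
  -- bounds dominates each of them.
  refine ⟨∑ i ∈ Finset.range (n + 1), B i, fun g hg i => ?_⟩
  by_cases hi : i ∈ Finset.range (n + 1)
  · exact (hB i g hg).trans (Finset.single_le_sum (fun j _ => hB0 j) hi)
  · rw [coeff_eq_zero_of_natDegree_lt, norm_zero]
    · exact Finset.sum_nonneg fun j _ => hB0 j
    · rw [Matrix.charpoly_natDegree_eq_dim, Fintype.card_fin]
      simpa using hi

theorem charpoly_inv_mul_mul {G : GroupKind} {n : ℕ} {R : Type*} [CommRing R]
    (x g : linGroup G n R) : (toMat (x⁻¹ * g * x)).charpoly = (toMat g).charpoly := by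
  have h : toMat (x⁻¹ * g * x) = toMat x⁻¹ * toMat g * toMat x := rfl
  rw [h, Matrix.charpoly_mul_comm, ← mul_assoc]
  have h1 : toMat x * toMat x⁻¹ = 1 := congrArg toMat (mul_inv_cancel x)
  rw [h1, one_mul]

/-! ### Characteristic polynomials of rational points -/

section Adelic

variable {F : Type*} [Field F] [NumberField F] {G : GroupKind} {n : ℕ}

/-- This removes the adelic element `x`: local information about the conjugate becomes information
about numbers in `F`. -/
theorem charpoly_conj_diagEmb (x : adelicGroup F G n) (γ : linGroup G n F) :
    (toMat (x⁻¹ * diagEmb F G n γ * x)).charpoly =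
      (toMat γ).charpoly.map (algebraMap F (AdeleRing (𝓞 F) F)) := by
  rw [charpoly_inv_mul_mul, ← Matrix.charpoly_map]
  rfl

theorem charpoly_coeff_mem {R : Type*} [CommRing R] (A : Subring R)
    {M : Matrix (Fin n) (Fin n) R} (hM : ∀ i j, M i j ∈ A) (i : ℕ) : M.charpoly.coeff i ∈ A := by
  let N : Matrix (Fin n) (Fin n) A := Matrix.of fun i j => ⟨M i j, hM i j⟩
  have hN : M = N.map A.subtype := rfl
  rw [hN, Matrix.charpoly_map, coeff_map]
  exact (N.charpoly.coeff i).2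

/-- At each finite place the coefficient is a polynomial with integer coefficients in local
integers, hence a local integer; an element of `F` integral at every finite place lies in `𝓞 F`. -/
theorem isIntegral_charpoly_coeff {x : adelicGroup F G n} {γ : linGroup G n F}
    (h : FinPartInKf (x⁻¹ * diagEmb F G n γ * x)) (i : ℕ) :
    IsIntegral ℤ ((toMat γ).charpoly.coeff i) := by
  obtain ⟨a, ha⟩ := HeightOneSpectrum.mem_integers_of_valuation_le_one (R := 𝓞 F) F
      ((toMat γ).charpoly.coeff i) fun v => by
    let ψ : AdeleRing (𝓞 F) F →+* v.adicCompletion F :=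
      { toFun := fun a => finProj F a v
        map_one' := rfl
        map_zero' := rfl
        map_mul' := fun _ _ => rfl
        map_add' := fun _ _ => rfl }
    have h1 : ((toMat (x⁻¹ * diagEmb F G n γ * x)).map ψ).charpoly.coeff i ∈
        (v.adicCompletionIntegers F).toSubring :=
      charpoly_coeff_mem _ (fun j k => (h v j k).1) i
    rw [Matrix.charpoly_map, charpoly_conj_diagEmb, coeff_map, coeff_map] at h1
    exact (HeightOneSpectrum.valuedAdicCompletion_eq_valuation' v _).symm.trans_le h1
  rw [← ha]
  exact a.isIntegral_coe

/-- Up to complex conjugation `φ` extends to the completion at its place `v`. Composed with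
`e.symm`, this gives a continuous ring homomorphism from `ℝ^r` to `ℂ`, which cannot increase norms.
Nothing about how `e` matches the factors is needed. -/
theorem norm_charpoly_coeff_le {r₁ r₂ : ℕ} (e : InfiniteAdeleRing F ≃+* ArchAlg r₁ r₂)
    (he : Continuous e.symm) {x : adelicGroup F G n} {γ : linGroup G n F} {i : ℕ} {B : ℝ}
    (h : ‖(toMat (linMap G n ((e : InfiniteAdeleRing F →+* ArchAlg r₁ r₂).comp (archProj F))
      (x⁻¹ * diagEmb F G n γ * x))).charpoly.coeff i‖ ≤ B) (φ : F →+* ℂ) :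
    ‖φ ((toMat γ).charpoly.coeff i)‖ ≤ B := by
  set v := InfinitePlace.mk φ
  set a := (toMat γ).charpoly.coeff i
  have h1 : (toMat (linMap G n ((e : InfiniteAdeleRing F →+* ArchAlg r₁ r₂).comp (archProj F))
      (x⁻¹ * diagEmb F G n γ * x))).charpoly.coeff i = e (algebraMap F (InfiniteAdeleRing F) a) := by
    change (((toMat (x⁻¹ * diagEmb F G n γ * x)).map
      ((e : InfiniteAdeleRing F →+* ArchAlg r₁ r₂).comp (archProj F))).charpoly).coeff i = _
    rw [Matrix.charpoly_map, charpoly_conj_diagEmb, coeff_map, coeff_map]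
    rfl
  rw [h1] at h
  let ψ : ArchAlg r₁ r₂ →+* ℂ := (InfinitePlace.Completion.extensionEmbedding v).comp
    ((Pi.evalRingHom (fun v : InfinitePlace F => v.Completion) v).comp
      (e.symm : ArchAlg r₁ r₂ →+* InfiniteAdeleRing F))
  have hψ : Continuous ψ :=
    (InfinitePlace.Completion.isometry_extensionEmbedding v).continuous.comp
      ((continuous_apply v).comp he)
  have h2 := norm_le_of_continuous_ringHom ψ hψ (e (algebraMap F (InfiniteAdeleRing F) a))
  have h3 : ψ (e (algebraMap F (InfiniteAdeleRing F) a)) = v.embedding a := by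
    change InfinitePlace.Completion.extensionEmbedding v
      (e.symm (e (algebraMap F (InfiniteAdeleRing F) a)) v) = _
    rw [e.symm_apply_apply]
    exact InfinitePlace.Completion.extensionEmbedding_coe v _
  -- The chosen embedding of `v` is `φ` or its complex conjugate, so the norms agree.
  rw [h3, InfinitePlace.norm_embedding_eq] at h2
  exact h2.trans h

/-! ### Discarding vanishing terms in the truncated integral -/

theorem truncKernel_eq_of_subset {φ : adelicGroup F G n → ℂ} (T : Fin n → ℝ)
    {A B : Set (linGroup G n F)} (hAB : A ⊆ B) {x : adelicGroup F G n}
    (h : ∀ γ ∈ B, φ (x⁻¹ * diagEmb F G n γ * x) ≠ 0 → γ ∈ A) :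
    truncKernel φ T B x = truncKernel φ T A x := by
  unfold truncKernel
  congr 1
  rw [tsum_subtype B fun γ => φ (x⁻¹ * diagEmb F G n γ * x),
    tsum_subtype A fun γ => φ (x⁻¹ * diagEmb F G n γ * x)]
  refine tsum_congr fun γ => ?_
  by_cases hA : γ ∈ A
  · rw [Set.indicator_of_mem hA, Set.indicator_of_mem (hAB hA)]
  · rw [Set.indicator_of_notMem hA, Set.indicator_apply_eq_zero]
    exact fun hB => by_contra fun h0 => hA (h γ hB h0)

/-- The integrands are equal at every point of the quotient, so no summability or integrability
enters. -/
theorem truncIntegral_eq_of_subset [MeasurableSpace (adelicOne F G n)]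
    (μ : Measure (adelicOne F G n)) {φ : adelicGroup F G n → ℂ} (T : Fin n → ℝ)
    {A B : Set (linGroup G n F)} (hA : ConjStable A) (hB : ConjStable B) (hAB : A ⊆ B)
    (h : ∀ x ∈ adelicOne F G n, ∀ γ ∈ B, φ (x⁻¹ * diagEmb F G n γ * x) ≠ 0 → γ ∈ A) :
    truncIntegral μ φ T B hB = truncIntegral μ φ T A hA := by
  have hq : truncKernelQuot φ T B hB = truncKernelQuot φ T A hA := by
    funext q
    induction q using Quotient.inductionOn with
    | h x => exact truncKernel_eq_of_subset T hAB (h x x.2)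
  unfold truncIntegral
  rw [hq]

end Adelic

end TruncTrace

open TruncTrace in
theorem mainTheorem6 (G : GroupKind) (n r₁ r₂ : ℕ) (hn : 2 ≤ n) (hd : 2 ≤ r₁ + 2 * r₂)
    (C : Set (linGroup G n (ArchAlg r₁ r₂))) (hC : IsCompact C) :
    ∃ S : Finset (AlgebraicClosure ℚ)[X],
      ∀ f : linGroup G n (ArchAlg r₁ r₂) → ℂ, IsSmooth f → HasCompactSupport f → tsupport f ⊆ C →
      ∀ (F : Type*) [Field F] [NumberField F],
        InfinitePlace.nrRealPlaces F = r₁ → InfinitePlace.nrComplexPlaces F = r₂ →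
      ∀ e : InfiniteAdeleRing F ≃+* ArchAlg r₁ r₂, Continuous e → Continuous e.symm →
      ∀ ι : F →+* AlgebraicClosure ℚ,
        (∀ x ∈ adelicOne F G n, ∀ γ : linGroup G n F,
          testFn e f (x⁻¹ * diagEmb F G n γ * x) ≠ 0 → γ ∈ classUnion G n ι S) ∧
        ∀ [MeasurableSpace (adelicOne F G n)] [BorelSpace (adelicOne F G n)]
          (μ : Measure (adelicOne F G n)) [μ.IsHaarMeasure] (ρ : ℝ), 0 < ρ →
        ∀ T : Fin n → ℝ, ∑ i, T i = 0 → (∀ i j : Fin n, i < j → 0 < T i - T j) →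
          (∀ i j : Fin n, i < j → ρ * Real.log |(discr F : ℝ)| ≤ T i - T j) →
          jNonCentral μ (testFn e f) T =
            truncIntegral μ (testFn e f) T
              (classUnion G n ι S \ (Subgroup.center (linGroup G n F) : Set (linGroup G n F)))
              (conjStable_classUnion ι S).diff_center := by
  classical
  obtain ⟨B, hB⟩ := exists_charpoly_coeff_bound hC
  obtain ⟨U, hU, hUF⟩ := exists_finite_of_bounded_conjugates (r₁ + 2 * r₂) B
  -- The required finite set: polynomials of degree at most `n` with coefficients in `U`, fixed by
  -- `C`, `n` and the signature before `F` is chosen.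
  have hfin := finite_setOf_natDegree_le_coeff_mem hU n
  refine ⟨hfin.toFinset, fun f _ _ hfC F _ _ hr₁ hr₂ e _ he ι => ?_⟩
  have hdeg : Module.finrank ℚ F = r₁ + 2 * r₂ := by
    rw [← InfinitePlace.card_add_two_mul_card_eq_rank, hr₁, hr₂]
  have key : ∀ x ∈ adelicOne F G n, ∀ γ : linGroup G n F,
      testFn e f (x⁻¹ * diagEmb F G n γ * x) ≠ 0 →
        γ ∈ classUnion G n ι hfin.toFinset := by
    intro x _ γ h
    refine mem_classUnion (hfin.mem_toFinset.2 ⟨?_, fun i => ?_⟩)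
    · exact natDegree_map_le.trans (by simp)
    have hK : FinPartInKf (x⁻¹ * diagEmb F G n γ * x) := by
      by_contra hK
      exact h (by rw [testFn, if_neg hK, mul_zero])
    rw [coeff_map]
    refine hUF F hdeg ι _ (isIntegral_charpoly_coeff hK i) ?_
    -- The archimedean factor of `f_F` is nonzero, so the archimedean component of the conjugate
    -- lies in `C`, where `B` bounds the coefficients.
    exact norm_charpoly_coeff_le e he (hB _ (hfC (subset_tsupport f (left_ne_zero_of_mul h))) i)
  refine ⟨key, fun μ _ ρ _ T _ _ _ => ?_⟩
  exact truncIntegral_eq_of_subset μ T _ _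
    (Set.sdiff_subset_sdiff_left (Set.subset_univ _)) fun x hx γ hγ h => ⟨key x hx γ h, hγ.2⟩
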